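/- Let $x_1,\dots,x_N\in\mathbb R^D$ be the columns of a matrix $X\in\mathbb R^{D\times N}$ and let $K$ be a number of clusters. Write $[K]=\{1,\dots,K\}$, $\mathbf e$ for the all-ones vector, $\operatorname{diag}(M)$ for the vector of diagonal entries of a square matrix $M$, $\mathbb{SOC}_+^{N+1}=\{(x,t)\in\mathbb R_+^{N}\times\mathbb R_+:\|x\|_2\le t\}$, $\mathcal B=\mathbb{SOC}_+^{N+1}\times\mathbb R_+^{N+1}$, and $\mathcal C(\mathcal K)=\operatorname{cl}\operatorname{conv}\{xx^\top:x\in\mathcal K\}$. The $K$-means clustering problem is $$Z^\star=\min\Big\{\sum_{i\in[K]}\sum_{n:\pi_{in}=1}\|x_n-c_i\|^2:\ \pi_i\in\{0,1\}^N,\ c_i=\tfrac{1}{\mathbf e^\top\pi_i}\sum_{n:\pi_{in}=1}x_n,\ \mathbf e^\top\pi_i\ge1\ \ \forall i\in[K],\ \sum_{i\in[K]}\pi_i=\mathbf e\Big\}.$$ **Theorem.** The following generalized completely positive program has the same optimal value as the $K$-means clustering problem (the value being $+\infty$ if a problem is infeasible), and if $1\le K\le N$ then this value is finite and is attained as a minimum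 in both problems: $$ \begin{array}{ccll} Z^\star=&\min& \operatorname{tr}(X^\top X)-\sum_{i\in[K]}\operatorname{tr}(X^\top X V_{ii})\\ &\text{s.t.}& \begin{bmatrix}Q_{11}&\cdots&Q_{1K}&p_1\\ \vdots&\ddots&\vdots&\vdots\\ Q_{K1}&\cdots&Q_{KK}&p_K\\ p_1^\top&\cdots&p_K^\top&1\end{bmatrix}\in\mathcal C(\mathcal B^K\times\mathbb R_+)\\ && p_i\in\mathcal B,\ Q_{ij}\in\mathbb R_+^{2(N+1)\times 2(N+1)},\ V_{ij},Y_{ij},G_{ij}\in\mathbb R_+^{N\times N},\ u_i,s_i,h_{ij},r_{ij}\in\mathbb R_+^N,\ w_i,z_{ij}\in\mathbb R_+&\forall i,j\in[K]\\ && p_i=\begin{bmatrix}u_i\\1\\s_i\\w_i\end{bmatrix},\quad Q_{ij}=\begin{bmatrix}V_{ij}&u_i&G_{ij}&h_{ij}\\u_j^\top&1&s_j^\top&w_j\\G_{ji}^\top&s_i&Y_{ij}&r_{ij}\\h_{ji}^\top&w_i&r_{ji}^\top&z_{ij}\end{bmatrix}&\forall i,j\in[K]\\ && \operatorname{tr}(V_{ii})=1\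 \ \forall i\in[K],\qquad \operatorname{tr}(V_{ij})=0\ \ \forall i\ne j,\qquad \sum_{i\in[K]}V_{ii}\mathbf e=\mathbf e\\ && \operatorname{diag}(V_{ii})=h_{ii},\quad u_i+s_i=w_i\mathbf e,\quad \operatorname{diag}(V_{ii}+Y_{ii}+2G_{ii})+z_{ii}\mathbf e-2h_{ii}-2r_{ii}=0&\forall i\in[K]. \end{array} $$ -/

import Mathlib

namespace KMeansCPP

open scoped Matrix

/-! ### The K-means clustering problem

The columns of `X : Matrix (Fin D) (Fin N) ℝ` are the `N` data points in `ℝ^D`. -/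

/-- The `n`-th data point, as a vector of Euclidean space. -/
noncomputable def point {D N : ℕ} (X : Matrix (Fin D) (Fin N) ℝ) (n : Fin N) :
    EuclideanSpace ℝ (Fin D) :=
  WithLp.toLp 2 (fun d => X d n)

/-- Feasibility of assignment vectors `π i` and centroids `c i` in the mixed-integer program
for K-means clustering. -/
structure IsKMeansFeasible {D N K : ℕ} (X : Matrix (Fin D) (Fin N) ℝ)
    (π : Fin K → Fin N → ℝ) (c : Fin K → EuclideanSpace ℝ (Fin D)) : Prop where
  binary : ∀ i n, π i n = 0 ∨ π i n = 1
  centroid : ∀ i, c i = (1 / ∑ n, π i n) • ∑ n with π i n = 1, point X n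
  nonempty : ∀ i, 1 ≤ ∑ n, π i n
  assigned : ∀ n, ∑ i, π i n = 1

/-- The sum of squared distances to the respective cluster centroids. -/
noncomputable def kmeansCost {D N K : ℕ} (X : Matrix (Fin D) (Fin N) ℝ)
    (π : Fin K → Fin N → ℝ) (c : Fin K → EuclideanSpace ℝ (Fin D)) : ℝ :=
  ∑ i, ∑ n with π i n = 1, ‖point X n - c i‖ ^ 2

/-- The objective values of all feasible K-means clusterings with `K` clusters. -/
def kmeansValues {D N : ℕ} (K : ℕ) (X : Matrix (Fin D) (Fin N) ℝ) : Set ℝ :=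
  {v | ∃ (π : Fin K → Fin N → ℝ) (c : Fin K → EuclideanSpace ℝ (Fin D)),
    IsKMeansFeasible X π c ∧ v = kmeansCost X π c}

/-! ### Cones -/

/-- `SOC_+^{n+1}`: pairs `(x, t)` with `‖x‖₂ ≤ t` and all components non-negative. -/
def socPlus (n : ℕ) : Set (Fin n ⊕ Unit → ℝ) :=
  {p | ‖(WithLp.toLp 2 (fun k => p (Sum.inl k)) : EuclideanSpace ℝ (Fin n))‖ ≤ p (Sum.inr ()) ∧
    ∀ a, 0 ≤ p a}

/-- The direct product of two sets of vectors, as a set of concatenated vectors. -/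
def prodVec {α β : Type*} (S : Set (α → ℝ)) (T : Set (β → ℝ)) : Set (α ⊕ β → ℝ) :=
  {x | (fun a => x (Sum.inl a)) ∈ S ∧ (fun b => x (Sum.inr b)) ∈ T}

/-- The non-negative orthant. -/
def orthant (α : Type*) : Set (α → ℝ) := {x | ∀ a, 0 ≤ x a}

/-- The direct product of `K` copies of a set of vectors, as a set of concatenated vectors. -/
def powVec {β : Type*} (B : Set (β → ℝ)) (K : ℕ) : Set (Fin K × β → ℝ) :=
  {x | ∀ i, (fun b => x (i, b)) ∈ B}

/-- The cone of completely positive matrices over `S`: `cl conv {x xᵀ : x ∈ S}`. -/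
def completelyPositive {ι : Type*} (S : Set (ι → ℝ)) : Set (Matrix ι ι ℝ) :=
  closure (convexHull ℝ {M | ∃ x ∈ S, M = Matrix.vecMulVec x x})

/-- The symmetric block matrix with blocks `Q i j`, last column `(p i)`, last row `(p j)ᵀ` and
lower right entry `1`. -/
def blockMatrix {β : Type*} {K : ℕ} (p : Fin K → β → ℝ) (Q : Fin K → Fin K → Matrix β β ℝ) :
    Matrix ((Fin K × β) ⊕ Unit) ((Fin K × β) ⊕ Unit) ℝ :=
  Matrix.fromBlocks
    (Matrix.of fun a b => Q a.1 b.1 a.2 b.2) (Matrix.of fun a _ => p a.1 a.2)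
    (Matrix.of fun _ b => p b.1 b.2) (Matrix.of fun _ _ => 1)

/-- The set `𝒲(B, K)` of pairs `((p i), (Q i j))` with `p i ∈ B`, `Q i j` entrywise non-negative,
and block matrix completely positive over `B^K × ℝ₊`. -/
def setW {β : Type*} (B : Set (β → ℝ)) (K : ℕ) :
    Set ((Fin K → β → ℝ) × (Fin K → Fin K → Matrix β β ℝ)) :=
  {pQ | (∀ i, pQ.1 i ∈ B) ∧ (∀ i j a b, 0 ≤ pQ.2 i j a b) ∧
    blockMatrix pQ.1 pQ.2 ∈ completelyPositive (prodVec (powVec B K) (orthant Unit))}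

/-- The set `𝒱(N, K)`. -/
def setV (N K : ℕ) : Set (Fin K → Fin K → Matrix (Fin N) (Fin N) ℝ) :=
  {V | (∀ i j a b, 0 ≤ V i j a b) ∧ (∀ i, (V i i).trace = 1) ∧
    ∀ i j, i ≠ j → (V i j).trace = 0}

/-! ### The generalized completely positive program -/

/-- The index set of the vectors `p i = (u i, 1, s i, w i)`. -/
abbrev Idx (N : ℕ) : Type := (Fin N ⊕ Unit) ⊕ (Fin N ⊕ Unit)

/-- The decision variables (without any constraint). -/
structure Vars (N K : ℕ) where
  p : Fin K → Idx N → ℝ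
  Q : Fin K → Fin K → Matrix (Idx N) (Idx N) ℝ
  V : Fin K → Fin K → Matrix (Fin N) (Fin N) ℝ
  Y : Fin K → Fin K → Matrix (Fin N) (Fin N) ℝ
  G : Fin K → Fin K → Matrix (Fin N) (Fin N) ℝ
  u : Fin K → Fin N → ℝ
  s : Fin K → Fin N → ℝ
  h : Fin K → Fin K → Fin N → ℝ
  r : Fin K → Fin K → Fin N → ℝ
  w : Fin K → ℝ
  z : Fin K → Fin K → ℝ

/-- The constraints of the generalized completely positive program. -/
structure IsFeasible {N K : ℕ} (x : Vars N K) : Prop where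
  mem_W : (x.p, x.Q) ∈ setW (prodVec (socPlus N) (orthant (Fin N ⊕ Unit))) K
  mem_V : x.V ∈ setV N K
  w_nonneg : ∀ i, 0 ≤ x.w i
  z_nonneg : ∀ i j, 0 ≤ x.z i j
  u_nonneg : ∀ i n, 0 ≤ x.u i n
  s_nonneg : ∀ i n, 0 ≤ x.s i n
  h_nonneg : ∀ i j n, 0 ≤ x.h i j n
  r_nonneg : ∀ i j n, 0 ≤ x.r i j n
  Y_nonneg : ∀ i j a b, 0 ≤ x.Y i j a b
  G_nonneg : ∀ i j a b, 0 ≤ x.G i j a b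
  p_eq : ∀ i, x.p i =
    Sum.elim (Sum.elim (x.u i) (fun _ => 1)) (Sum.elim (x.s i) (fun _ => x.w i))
  Q_eq : ∀ i j, x.Q i j = Matrix.fromBlocks
    (Matrix.fromBlocks
      (x.V i j)                         (Matrix.replicateCol Unit (x.u i))
      (Matrix.replicateRow Unit (x.u j)) (Matrix.of fun _ _ => 1))
    (Matrix.fromBlocks
      (x.G i j)                         (Matrix.replicateCol Unit (x.h i j))
      (Matrix.replicateRow Unit (x.s j)) (Matrix.of fun _ _ => x.w j))
    (Matrix.fromBlocks
      (x.G j i)ᵀ                          (Matrix.replicateCol Unit (x.s i))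
      (Matrix.replicateRow Unit (x.h j i)) (Matrix.of fun _ _ => x.w i))
    (Matrix.fromBlocks
      (x.Y i j)                           (Matrix.replicateCol Unit (x.r i j))
      (Matrix.replicateRow Unit (x.r j i)) (Matrix.of fun _ _ => x.z i j))
  sum_V : ∑ i, x.V i i *ᵥ (fun _ => 1) = fun _ => 1
  diag_V : ∀ i, (x.V i i).diag = x.h i i
  linear : ∀ i, x.u i + x.s i = fun _ => x.w i
  squared : ∀ i, (x.V i i + x.Y i i + (2 : ℝ) • x.G i i).diag + (fun _ => x.z i i)
    - (2 : ℝ) • x.h i i - (2 : ℝ) • x.r i i = 0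

/-- The linear objective `tr(XᵀX) - ∑ i, tr(XᵀX V i i)`. -/
noncomputable def objective {D N K : ℕ} (X : Matrix (Fin D) (Fin N) ℝ) (x : Vars N K) : ℝ :=
  (Xᵀ * X).trace - ∑ i, (Xᵀ * X * x.V i i).trace

/-- The objective values of all feasible points of the generalized completely positive program. -/
def cppValues {D N : ℕ} (K : ℕ) (X : Matrix (Fin D) (Fin N) ℝ) : Set ℝ :=
  {v | ∃ x : Vars N K, IsFeasible x ∧ v = objective X x}

end KMeansCPP

/-! A clustering lifts to a feasible rank-one point of equal cost: take `u i` to be the indicator of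
cluster `i` divided by the square root of its size, so that the cost is linear in the matrices `u i
(u i)ᵀ` (`kmeansCost_eq`, `kmeansValues_subset_cppValues`).

Conversely, the block matrix of a feasible point is a finite sum of terms `y l (y l)ᵀ` with `y l` in
the cone (`exists_sum_vecMulVec_of_mem_completelyPositive`). The last coordinates `α l` satisfy `∑ α
l ^ 2 = 1`. Each aggregated constraint is the sum over `l` of inequalities valid for every single
term, with equal totals, so it holds term by term (`eq_of_sum_eq_of_le`). Hence every term with `α l
≠ 0`, divided by `α l`, encodes a clustering. The objective is the convex combination of their costs
with weights `α l ^ 2`, so some clustering costs no more (`exists_kmeansValue_le`). -/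

namespace KMeansCPP

open scoped Matrix

/-! ### Finite decomposition of generalized completely positive matrices -/

/-- Carathéodory: the convex hull of the rank-one matrices over a cone consists of sums of a
bounded number of rank-one matrices. -/
theorem exists_sum_vecMulVec_of_mem_convexHull {ι : Type*} [Fintype ι] {S : Set (ι → ℝ)}
    (hS : ∀ r : ℝ, 0 ≤ r → ∀ x ∈ S, r • x ∈ S) {M : Matrix ι ι ℝ}
    (hM : M ∈ convexHull ℝ {M | ∃ x ∈ S, M = Matrix.vecMulVec x x}) :
    ∃ y : Fin (Module.finrank ℝ (Matrix ι ι ℝ) + 1) → ι → ℝ,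
      (∀ l, y l ∈ S) ∧ M = ∑ l, Matrix.vecMulVec (y l) (y l) := by
  obtain ⟨κ, _, z, c, hz, hind, hc, hsum, rfl⟩ := eq_pos_convex_span_of_mem_convexHull hM
  choose x hxS hx using fun k => hz ⟨k, rfl⟩
  obtain ⟨f⟩ : Nonempty (κ ↪ Fin (Module.finrank ℝ (Matrix ι ι ℝ) + 1)) := by
    refine Function.Embedding.nonempty_of_card_le ?_
    rw [Fintype.card_fin]
    exact hind.card_le_finrank_succ.trans
      (Nat.succ_le_succ (Submodule.finrank_le (vectorSpan ℝ (Set.range z))))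
  have hne : Nonempty κ := by
    by_contra h
    have := not_nonempty_iff.1 h
    simp at hsum
  have h0 : (0 : ι → ℝ) ∈ S := by
    simpa using hS 0 le_rfl _ (hxS hne.some)
  -- The cone property absorbs each convex weight as a square root; unused slots are padded with
  -- zero, so the number of terms does not depend on `M`.
  refine ⟨Function.extend f (fun k => Real.sqrt (c k) • x k) 0, fun l => ?_, ?_⟩
  · by_cases hl : ∃ k, f k = l
    · obtain ⟨k, rfl⟩ := hl
      rw [f.injective.extend_apply]
      exact hS _ (Real.sqrt_nonneg _) _ (hxS k)
    · rw [Function.extend_apply' _ _ _ hl]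
      exact h0
  · refine Fintype.sum_of_injective f f.injective _ _ (fun l hl => ?_) (fun k => ?_)
    · rw [Function.extend_apply' _ _ _ hl]
      ext a b
      simp [Matrix.vecMulVec_apply]
    · rw [f.injective.extend_apply, hx]
      ext a b
      simp only [Matrix.smul_apply, Matrix.vecMulVec_apply, Pi.smul_apply, smul_eq_mul]
      linear_combination (- x k a * x k b) * Real.mul_self_sqrt (hc k).le

/-- Over a closed cone, completely positive matrices are finite sums of rank-one matrices. -/
theorem exists_sum_vecMulVec_of_mem_completelyPositive {ι : Type*} [Fintype ι]
    {S : Set (ι → ℝ)} (hcl : IsClosed S) (hS : ∀ r : ℝ, 0 ≤ r → ∀ x ∈ S, r • x ∈ S)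
    {M : Matrix ι ι ℝ} (hM : M ∈ completelyPositive S) :
    ∃ (m : ℕ) (y : Fin m → ι → ℝ),
      (∀ l, y l ∈ S) ∧ M = ∑ l, Matrix.vecMulVec (y l) (y l) := by
  set m := Module.finrank ℝ (Matrix ι ι ℝ) + 1
  -- The trace of `∑ y yᵀ` is the total squared norm of the `y l`, so a trace bound makes the
  -- factors range over a compact set. The slack `+ 1` makes `trace < B` an open neighbourhood of
  -- `M`, hence `M` stays in the closure of the truncated hull.
  set B := M.trace + 1
  let C : Set (Fin m → ι → ℝ) := Set.univ.pi (fun _ => S) ∩ {y | ∑ l, ∑ a, y l a ^ 2 ≤ B}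
  have hC : IsCompact C := by
    refine Metric.isCompact_of_isClosed_isBounded ?_ ?_
    · refine IsClosed.inter ?_ ?_
      · exact isClosed_set_pi fun _ _ => hcl
      · exact isClosed_le (f := fun y : Fin m → ι → ℝ => ∑ l, ∑ a, y l a ^ 2) (by fun_prop)
          continuous_const
    · refine (Metric.isBounded_closedBall (x := (0 : Fin m → ι → ℝ)) (r := B + 1)).subset ?_
      rintro y ⟨-, hy⟩
      have hsq : ∀ l a, y l a ^ 2 ≤ B := fun l a =>
        ((Finset.single_le_sum (f := fun a => y l a ^ 2) (fun _ _ => sq_nonneg _)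
          (Finset.mem_univ a)).trans (Finset.single_le_sum (f := fun l => ∑ a, y l a ^ 2)
          (fun _ _ => Finset.sum_nonneg fun _ _ => sq_nonneg _) (Finset.mem_univ l))).trans hy
      have hB : 0 ≤ B := le_trans
        (Finset.sum_nonneg fun _ _ => Finset.sum_nonneg fun _ _ => sq_nonneg _) hy
      rw [mem_closedBall_zero_iff, pi_norm_le_iff_of_nonneg (by linarith)]
      intro l
      rw [pi_norm_le_iff_of_nonneg (by linarith)]
      intro a
      rw [Real.norm_eq_abs]
      exact abs_le_of_sq_le_sq (by nlinarith [hsq l a]) (by linarith)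
  let F : (Fin m → ι → ℝ) → Matrix ι ι ℝ := fun y => ∑ l, Matrix.vecMulVec (y l) (y l)
  have hF : Continuous F := by
    refine continuous_finsetSum _ fun l _ => ?_
    exact (continuous_apply l).matrix_vecMulVec (continuous_apply l)
  have hopen : IsOpen {P : Matrix ι ι ℝ | P.trace < B} :=
    isOpen_lt (continuous_id.matrix_trace) continuous_const
  have hmem := hopen.inter_closure ⟨show M.trace < B by simp [B], hM⟩
  have hsub : {P : Matrix ι ι ℝ | P.trace < B} ∩
      convexHull ℝ {M | ∃ x ∈ S, M = Matrix.vecMulVec x x} ⊆ F '' C := by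
    rintro P ⟨hP, hP'⟩
    obtain ⟨y, hyS, rfl⟩ := exists_sum_vecMulVec_of_mem_convexHull hS hP'
    refine ⟨y, ⟨fun l _ => hyS l, ?_⟩, rfl⟩
    refine (le_of_eq_of_le ?_ (le_of_lt hP) : ∑ l, ∑ a, y l a ^ 2 ≤ B)
    simp only [Matrix.trace_sum, Matrix.trace_vecMulVec, dotProduct, sq]
  obtain ⟨y, hy, h⟩ := closure_minimal hsub (hC.image hF).isClosed hmem
  exact ⟨m, y, fun l => hy.1 l trivial, h.symm⟩

/-! ### The K-means cost in terms of the Gram matrix -/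

theorem trace_gram_mul_vecMulVec {D N : ℕ} (X : Matrix (Fin D) (Fin N) ℝ) (v : Fin N → ℝ) :
    (Xᵀ * X * Matrix.vecMulVec v v).trace = ∑ d, (∑ n, X d n * v n) ^ 2 := by
  rw [Matrix.mul_vecMulVec, Matrix.trace_vecMulVec, ← Matrix.mulVec_mulVec, dotProduct_comm,
    Matrix.dotProduct_mulVec, Matrix.vecMul_transpose]
  simp [dotProduct, Matrix.mulVec, sq]

theorem trace_gram {D N : ℕ} (X : Matrix (Fin D) (Fin N) ℝ) :
    (Xᵀ * X).trace = ∑ n, ‖point X n‖ ^ 2 := by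
  simp [Matrix.trace, Matrix.mul_apply, point, EuclideanSpace.norm_sq_eq, ← sq]

/-- A sum over a cluster in terms of its binary indicator vector. -/
theorem sum_filter_eq_one {N : ℕ} {E : Type*} [AddCommGroup E] [Module ℝ E] {a : Fin N → ℝ}
    (ha : ∀ n, a n = 0 ∨ a n = 1) (f : Fin N → E) :
    ∑ n with a n = 1, f n = ∑ n, a n • f n := by
  rw [Finset.sum_filter]
  refine Finset.sum_congr rfl fun n _ => ?_
  rcases ha n with h | h <;> simp [h]

/-- The scatter of a finite family about its mean. -/
theorem sum_norm_sub_mean_sq {ι E : Type*} [NormedAddCommGroup E] [InnerProductSpace ℝ E]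
    (A : Finset ι) (f : ι → E) {w : ℝ} (hw : w ^ 2 * A.card = 1) :
    ∑ n ∈ A, ‖f n - (1 / (A.card : ℝ)) • ∑ k ∈ A, f k‖ ^ 2 =
      ∑ n ∈ A, ‖f n‖ ^ 2 - w ^ 2 * ‖∑ n ∈ A, f n‖ ^ 2 := by
  have hm : (A.card : ℝ) ≠ 0 := by rintro h; simp [h] at hw
  have hw' : w ^ 2 = 1 / (A.card : ℝ) := by field_simp; exact hw
  simp only [norm_sub_sq_real, Finset.sum_add_distrib, Finset.sum_sub_distrib, ← Finset.mul_sum,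
    ← sum_inner, Finset.sum_const, nsmul_eq_mul, inner_smul_right, real_inner_self_eq_norm_sq,
    norm_smul, Real.norm_eq_abs, mul_pow, sq_abs]
  rw [hw']
  field_simp
  ring

/-- The K-means cost as a linear function of the rank-one matrices of the normalised cluster
indicators. -/
theorem kmeansCost_eq {D N K : ℕ} {X : Matrix (Fin D) (Fin N) ℝ}
    {π : Fin K → Fin N → ℝ} {c : Fin K → EuclideanSpace ℝ (Fin D)}
    (h : IsKMeansFeasible X π c) {w : Fin K → ℝ} (hw : ∀ i, w i ^ 2 * ∑ n, π i n = 1) :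
    kmeansCost X π c = (Xᵀ * X).trace - ∑ i, (Xᵀ * X *
      Matrix.vecMulVec (fun n => π i n * w i) (fun n => π i n * w i)).trace := by
  have hcard : ∀ i, ∑ n, π i n = (({n | π i n = 1} : Finset (Fin N)).card : ℝ) := fun i => by
    have := sum_filter_eq_one (h.binary i) (fun _ => (1 : ℝ))
    simpa using this.symm
  have hcluster : ∀ i, ∑ n with π i n = 1, ‖point X n - c i‖ ^ 2 =
      ∑ n, π i n * ‖point X n‖ ^ 2 - (Xᵀ * X *
        Matrix.vecMulVec (fun n => π i n * w i) (fun n => π i n * w i)).trace := fun i => by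
    rw [h.centroid i, hcard, sum_norm_sub_mean_sq _ _ (w := w i) (by rw [← hcard]; exact hw i),
      sum_filter_eq_one (h.binary i), sum_filter_eq_one (h.binary i), trace_gram_mul_vecMulVec,
      EuclideanSpace.norm_sq_eq, Finset.mul_sum]
    congr 1
    refine Finset.sum_congr rfl fun d _ => ?_
    rw [Real.norm_eq_abs, sq_abs, ← mul_pow]
    congr 1
    simp only [point, WithLp.ofLp_sum, WithLp.ofLp_smul, Finset.sum_apply, Pi.smul_apply,
      smul_eq_mul, Finset.mul_sum]
    exact Finset.sum_congr rfl fun n _ => by ring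
  rw [kmeansCost, Finset.sum_congr rfl fun i _ => hcluster i, Finset.sum_sub_distrib, trace_gram,
    Finset.sum_comm]
  simp only [← Finset.sum_mul, h.assigned, one_mul]

/-! ### From clusterings to feasible points -/

/-- The rank-one point of the generalized completely positive program built from vectors `u i`
and scalars `w i`. -/
def Vars.rankOne {N K : ℕ} (u : Fin K → Fin N → ℝ) (w : Fin K → ℝ) : Vars N K where
  p i := Sum.elim (Sum.elim (u i) fun _ => 1) (Sum.elim (fun n => w i - u i n) fun _ => w i)
  Q i j := Matrix.vecMulVec
    (Sum.elim (Sum.elim (u i) fun _ => 1) (Sum.elim (fun n => w i - u i n) fun _ => w i))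
    (Sum.elim (Sum.elim (u j) fun _ => 1) (Sum.elim (fun n => w j - u j n) fun _ => w j))
  V i j := Matrix.vecMulVec (u i) (u j)
  Y i j := Matrix.vecMulVec (fun n => w i - u i n) (fun n => w j - u j n)
  G i j := Matrix.vecMulVec (u i) (fun n => w j - u j n)
  u := u
  s i n := w i - u i n
  h i j n := u i n * w j
  r i j n := (w i - u i n) * w j
  w := w
  z i j := w i * w j

theorem Vars.rankOne_isFeasible {N K : ℕ} {u : Fin K → Fin N → ℝ} {w : Fin K → ℝ}
    (hu : ∀ i n, 0 ≤ u i n) (huw : ∀ i n, u i n ≤ w i) (hw : ∀ i, 0 ≤ w i)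
    (hsq : ∀ i, ∑ n, u i n ^ 2 = 1) (horth : ∀ i j, i ≠ j → ∀ n, u i n * u j n = 0)
    (hbin : ∀ i n, u i n * u i n = u i n * w i) (hcov : ∀ n, ∑ i, u i n * ∑ k, u i k = 1) :
    IsFeasible (Vars.rankOne u w) := by
  have hp : ∀ i a, 0 ≤ (Vars.rankOne u w).p i a := by
    rintro i ((n | _) | (n | _)) <;> simp [Vars.rankOne, hu, huw, hw]
  have hB : ∀ i, (Vars.rankOne u w).p i ∈ prodVec (socPlus N) (orthant (Fin N ⊕ Unit)) := by
    refine fun i => ⟨⟨?_, fun a => hp i _⟩, fun a => hp i _⟩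
    -- The second-order cone bound is tight: `u i` has norm exactly `1`.
    rw [EuclideanSpace.norm_eq]
    simp [Vars.rankOne, hsq]
  exact
  { mem_W := by
      refine ⟨hB, fun i j a b => mul_nonneg (hp i a) (hp j b), ?_⟩
      refine subset_closure (subset_convexHull ℝ _
        ⟨Sum.elim (fun a => (Vars.rankOne u w).p a.1 a.2) fun _ => 1,
          ⟨fun i => hB i, fun _ => zero_le_one⟩, ?_⟩)
      ext (a | a) (b | b) <;> simp [blockMatrix, Matrix.vecMulVec_apply, Vars.rankOne]
    mem_V := by
      refine ⟨fun i j a b => mul_nonneg (hu i a) (hu j b), fun i => ?_, fun i j hij => ?_⟩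
      · simpa [Vars.rankOne, Matrix.trace_vecMulVec, dotProduct, sq] using hsq i
      · simp [Vars.rankOne, Matrix.trace_vecMulVec, dotProduct, horth i j hij]
    w_nonneg := hw
    z_nonneg := fun i j => mul_nonneg (hw i) (hw j)
    u_nonneg := hu
    s_nonneg := fun i n => sub_nonneg.2 (huw i n)
    h_nonneg := fun i j n => mul_nonneg (hu i n) (hw j)
    r_nonneg := fun i j n => mul_nonneg (sub_nonneg.2 (huw i n)) (hw j)
    Y_nonneg := fun i j a b => mul_nonneg (sub_nonneg.2 (huw i a)) (sub_nonneg.2 (huw j b))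
    G_nonneg := fun i j a b => mul_nonneg (hu i a) (sub_nonneg.2 (huw j b))
    p_eq := fun i => rfl
    Q_eq := by
      intro i j
      ext ((a | a) | (a | a)) ((b | b) | (b | b)) <;>
        simp [Vars.rankOne, Matrix.vecMulVec_apply, mul_comm]
    sum_V := by
      ext n
      simpa [Vars.rankOne, Matrix.mulVec, dotProduct, Matrix.vecMulVec_apply, ← Finset.mul_sum]
        using hcov n
    diag_V := by
      intro i
      ext n
      simpa [Vars.rankOne, Matrix.vecMulVec_apply] using hbin i n
    linear := by
      intro i
      ext n
      simp [Vars.rankOne]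
    squared := by
      intro i
      ext n
      simp only [Vars.rankOne, Matrix.vecMulVec_apply, Matrix.diag_apply, Matrix.add_apply,
        Matrix.smul_apply, Pi.add_apply, Pi.sub_apply, Pi.smul_apply, smul_eq_mul, Pi.zero_apply]
      ring }

theorem kmeansValues_subset_cppValues {D N : ℕ} (K : ℕ) (X : Matrix (Fin D) (Fin N) ℝ) :
    kmeansValues K X ⊆ cppValues K X := by
  rintro _ ⟨π, c, h, rfl⟩
  let w : Fin K → ℝ := fun i => 1 / Real.sqrt (∑ n, π i n)
  have hpos : ∀ i, 0 < ∑ n, π i n := fun i => one_pos.trans_le (h.nonempty i)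
  have hw0 : ∀ i, 0 ≤ w i := fun i => by positivity
  have hw : ∀ i, w i ^ 2 * ∑ n, π i n = 1 := fun i => by
    simp only [w, div_pow, Real.sq_sqrt (hpos i).le]
    field_simp [(hpos i).ne']
  have hnn : ∀ i n, 0 ≤ π i n := fun i n => by rcases h.binary i n with h | h <;> simp [h]
  have hle : ∀ i n, π i n ≤ 1 := fun i n => by rcases h.binary i n with h | h <;> simp [h]
  have hsq : ∀ i n, π i n * π i n = π i n := fun i n => by
    rcases h.binary i n with h | h <;> simp [h]
  refine ⟨Vars.rankOne (fun i n => π i n * w i) w, Vars.rankOne_isFeasible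
    (fun i n => mul_nonneg (hnn i n) (hw0 i))
    (fun i n => mul_le_of_le_one_left (hw0 i) (hle i n)) hw0 (fun i => ?_)
    (fun i j hij n => ?_) (fun i n => ?_) (fun n => ?_), kmeansCost_eq h hw⟩
  · rw [← hw i, Finset.mul_sum]
    exact Finset.sum_congr rfl fun n _ => by linear_combination w i ^ 2 * hsq i n
  · have h2 : π i n + π j n ≤ 1 := by
      rw [← h.assigned n, ← Finset.sum_pair (f := fun i => π i n) hij]
      exact Finset.sum_le_sum_of_subset_of_nonneg (Finset.subset_univ _) fun k _ _ => hnn k n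
    rcases h.binary i n with h1 | h1
    · simp [h1]
    · have : π j n = 0 := le_antisymm (by linarith) (hnn j n)
      simp [this]
  · linear_combination w i ^ 2 * hsq i n
  · rw [← h.assigned n]
    refine Finset.sum_congr rfl fun i _ => ?_
    rw [← Finset.sum_mul]
    linear_combination π i n * hw i

/-! ### Closedness and scaling of the cones -/

theorem isClosed_socPlus (n : ℕ) : IsClosed (socPlus n) := by
  refine IsClosed.inter ?_ ?_
  · refine isClosed_le (f := fun p : Fin n ⊕ Unit → ℝ =>
      ‖(WithLp.toLp 2 (fun k => p (Sum.inl k)) : EuclideanSpace ℝ (Fin n))‖) ?_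
      (continuous_apply _)
    simp only [EuclideanSpace.norm_eq]
    fun_prop
  · rw [show (fun p : Fin n ⊕ Unit → ℝ => ∀ a, 0 ≤ p a) = Set.Ici 0 from rfl]
    exact isClosed_Ici

theorem isClosed_orthant (α : Type*) : IsClosed (orthant α) :=
  show IsClosed (Set.Ici (0 : α → ℝ)) from isClosed_Ici

theorem isClosed_prodVec {α β : Type*} {S : Set (α → ℝ)} {T : Set (β → ℝ)} (hS : IsClosed S)
    (hT : IsClosed T) : IsClosed (prodVec S T) :=
  (hS.preimage (f := fun x : α ⊕ β → ℝ => fun a => x (Sum.inl a)) (by fun_prop)).inter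
    (hT.preimage (f := fun x : α ⊕ β → ℝ => fun b => x (Sum.inr b)) (by fun_prop))

theorem isClosed_powVec {β : Type*} {B : Set (β → ℝ)} (hB : IsClosed B) (K : ℕ) :
    IsClosed (powVec B K) := by
  have : powVec B K = ⋂ i, (fun x : Fin K × β → ℝ => fun b => x (i, b)) ⁻¹' B := by
    ext x
    simp [powVec]
  rw [this]
  exact isClosed_iInter fun i => hB.preimage (by fun_prop)

theorem smul_mem_socPlus {n : ℕ} (r : ℝ) (hr : 0 ≤ r) (p) (hp : p ∈ socPlus n) :
    r • p ∈ socPlus n := by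
  refine ⟨?_, fun a => mul_nonneg hr (hp.2 a)⟩
  have : (WithLp.toLp 2 fun k => (r • p) (Sum.inl k) : EuclideanSpace ℝ (Fin n)) =
      r • WithLp.toLp 2 fun k => p (Sum.inl k) := rfl
  rw [this, norm_smul, Real.norm_of_nonneg hr]
  exact mul_le_mul_of_nonneg_left hp.1 hr

/-! ### From feasible points to clusterings -/

/-- A family of orthogonal normalised cluster indicators covering all points gives a value of the
K-means problem. -/
theorem mem_kmeansValues_of_indicators {D N K : ℕ} (X : Matrix (Fin D) (Fin N) ℝ)
    {u : Fin K → Fin N → ℝ} {w : Fin K → ℝ} (hbin : ∀ i n, u i n = 0 ∨ u i n = w i)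
    (hsq : ∀ i, ∑ n, u i n ^ 2 = 1) (horth : ∀ i j, i ≠ j → ∀ n, u i n * u j n = 0)
    (hcov : ∀ n, ∃ i, u i n ≠ 0) :
    (Xᵀ * X).trace - ∑ i, (Xᵀ * X * Matrix.vecMulVec (u i) (u i)).trace ∈ kmeansValues K X := by
  classical
  let π : Fin K → Fin N → ℝ := fun i n => if u i n = 0 then 0 else 1
  have hu : ∀ i n, u i n = π i n * w i := fun i n => by
    by_cases h0 : u i n = 0
    · simp [π, h0]
    · simpa [π, h0] using (hbin i n).resolve_left h0
  have hfeas : IsKMeansFeasible X π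
      (fun i => (1 / ∑ n, π i n) • ∑ n with π i n = 1, point X n) := by
    refine ⟨fun i n => ?_, fun i => rfl, fun i => ?_, fun n => ?_⟩
    · by_cases h0 : u i n = 0 <;> simp [π, h0]
    · obtain ⟨n, hn⟩ : ∃ n, u i n ≠ 0 := by
        by_contra! h
        simpa [h] using hsq i
      have h1 : π i n = 1 := by simp [π, hn]
      rw [← h1]
      exact Finset.single_le_sum (f := π i) (fun k _ => by dsimp [π]; split_ifs <;> simp)
        (Finset.mem_univ n)
    · obtain ⟨i, hi⟩ := hcov n
      rw [Finset.sum_eq_single i]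
      · simp [π, hi]
      · intro j _ hj
        simpa [π, hi] using horth j i hj n
      · simp
  refine ⟨π, _, hfeas, ?_⟩
  rw [kmeansCost_eq hfeas (w := w)]
  · simp only [← hu]
  · intro i
    rw [← hsq i, Finset.mul_sum]
    refine Finset.sum_congr rfl fun n _ => ?_
    rw [hu]
    rcases hfeas.binary i n with h | h <;> simp [h]

/-- This passes from constraints on the summed matrix to constraints on its individual rank-one
terms. -/
theorem eq_of_sum_eq_of_le {m : ℕ} {f g : Fin m → ℝ} (hle : ∀ l, f l ≤ g l)
    (h : ∑ l, f l = ∑ l, g l) (l : Fin m) : f l = g l :=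
  (Finset.sum_eq_sum_iff_of_le fun l _ => hle l).1 h l (Finset.mem_univ l)

theorem exists_kmeansValue_le {D N K : ℕ} (X : Matrix (Fin D) (Fin N) ℝ) {x : Vars N K}
    (hx : IsFeasible x) : ∃ v ∈ kmeansValues K X, v ≤ objective X x := by
  obtain ⟨m, y, hyS, hM⟩ := exists_sum_vecMulVec_of_mem_completelyPositive
    (isClosed_prodVec (isClosed_powVec
      (isClosed_prodVec (isClosed_socPlus N) (isClosed_orthant _)) K) (isClosed_orthant _))
    (fun r hr p hp => ⟨fun i => ⟨smul_mem_socPlus r hr _ (hp.1 i).1,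
      fun a => mul_nonneg hr ((hp.1 i).2 a)⟩, fun a => mul_nonneg hr (hp.2 a)⟩) hx.mem_W.2.2
  have hentry : ∀ a b, blockMatrix x.p x.Q a b = ∑ l, y l a * y l b := fun a b => by
    rw [hM, Matrix.sum_apply]
    rfl
  have hp : ∀ i a, x.p i a = ∑ l, y l (Sum.inl (i, a)) * y l (Sum.inr ()) :=
    fun i a => hentry (Sum.inl (i, a)) (Sum.inr ())
  have hQ : ∀ i j a b, x.Q i j a b = ∑ l, y l (Sum.inl (i, a)) * y l (Sum.inl (j, b)) :=
    fun i j a b => hentry (Sum.inl (i, a)) (Sum.inl (j, b))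
  let α : Fin m → ℝ := fun l => y l (Sum.inr ())
  let u : Fin m → Fin K → Fin N → ℝ := fun l i n => y l (Sum.inl (i, Sum.inl (Sum.inl n)))
  let t : Fin m → Fin K → ℝ := fun l i => y l (Sum.inl (i, Sum.inl (Sum.inr ())))
  let s : Fin m → Fin K → Fin N → ℝ := fun l i n => y l (Sum.inl (i, Sum.inr (Sum.inl n)))
  let w : Fin m → Fin K → ℝ := fun l i => y l (Sum.inl (i, Sum.inr (Sum.inr ())))
  have hα : ∑ l, α l * α l = 1 := (hentry (Sum.inr ()) (Sum.inr ())).symm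
  have ht1 : ∀ i, ∑ l, t l i * α l = 1 := fun i => by
    rw [← hp i (Sum.inl (Sum.inr ())), hx.p_eq]
    rfl
  have ht2 : ∀ i, ∑ l, t l i * t l i = 1 := fun i => by
    rw [← hQ i i (Sum.inl (Sum.inr ())) (Sum.inl (Sum.inr ())), hx.Q_eq]
    rfl
  have hV : ∀ i j a b, x.V i j a b = ∑ l, u l i a * u l j b := fun i j a b => by
    rw [← hQ i j (Sum.inl (Sum.inl a)) (Sum.inl (Sum.inl b)), hx.Q_eq]
    rfl
  have hG : ∀ i j a b, x.G i j a b = ∑ l, u l i a * s l j b := fun i j a b => by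
    rw [← hQ i j (Sum.inl (Sum.inl a)) (Sum.inr (Sum.inl b)), hx.Q_eq]
    rfl
  have hY : ∀ i j a b, x.Y i j a b = ∑ l, s l i a * s l j b := fun i j a b => by
    rw [← hQ i j (Sum.inr (Sum.inl a)) (Sum.inr (Sum.inl b)), hx.Q_eq]
    rfl
  have hh : ∀ i j a, x.h i j a = ∑ l, u l i a * w l j := fun i j a => by
    rw [← hQ i j (Sum.inl (Sum.inl a)) (Sum.inr (Sum.inr ())), hx.Q_eq]
    rfl
  have hr : ∀ i j a, x.r i j a = ∑ l, s l i a * w l j := fun i j a => by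
    rw [← hQ i j (Sum.inr (Sum.inl a)) (Sum.inr (Sum.inr ())), hx.Q_eq]
    rfl
  have hz : ∀ i j, x.z i j = ∑ l, w l i * w l j := fun i j => by
    rw [← hQ i j (Sum.inr (Sum.inr ())) (Sum.inr (Sum.inr ())), hx.Q_eq]
    rfl
  have hα0 : ∀ l, 0 ≤ α l := fun l => (hyS l).2 ()
  have hu0 : ∀ l i n, 0 ≤ u l i n := fun l i n => ((hyS l).1 i).1.2 (Sum.inl n)
  have hs0 : ∀ l i n, 0 ≤ s l i n := fun l i n => ((hyS l).1 i).2 (Sum.inl n)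
  -- Equality in Cauchy–Schwarz: `∑ t * α`, `∑ t * t` and `∑ α * α` all equal `1`, so the squared
  -- differences sum to zero.
  have htα : ∀ i l, t l i = α l := fun i l => by
    have h := eq_of_sum_eq_of_le (f := fun _ => 0) (g := fun l => (t l i - α l) ^ 2)
      (fun l => sq_nonneg _) (by
        have : ∀ l, (t l i - α l) ^ 2 = t l i * t l i - 2 * (t l i * α l) + α l * α l :=
          fun l => by ring
        simp only [this, Finset.sum_add_distrib, Finset.sum_sub_distrib, ← Finset.mul_sum, hα,
          ht1, ht2]
        norm_num) l
    exact sub_eq_zero.1 (pow_eq_zero_iff two_ne_zero |>.1 h.symm)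
  have hsoc : ∀ i l, ∑ n, u l i n ^ 2 ≤ α l * α l := fun i l => by
    have h : ‖(WithLp.toLp 2 (u l i) : EuclideanSpace ℝ (Fin N))‖ ≤ t l i := ((hyS l).1 i).1.1
    rw [htα] at h
    have h2 := mul_self_le_mul_self (norm_nonneg _) h
    rw [← sq, EuclideanSpace.norm_sq_eq] at h2
    simpa using h2
  -- The second-order cone gives `≤` in each term, and `tr V i i = 1 = ∑ α * α` forces equality.
  have hsq : ∀ i l, ∑ n, u l i n ^ 2 = α l * α l := fun i l => by
    refine eq_of_sum_eq_of_le (hsoc i) ?_ l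
    rw [hα, ← hx.mem_V.2.1 i, Finset.sum_comm]
    simp [Matrix.trace, hV, sq]
  -- The constraint `squared` says exactly that the squares of `u + s - w` sum to zero over `l`.
  have hlin : ∀ i n l, u l i n + s l i n = w l i := fun i n l => by
    have h := eq_of_sum_eq_of_le (f := fun _ => 0) (g := fun l => (u l i n + s l i n - w l i) ^ 2)
      (fun l => sq_nonneg _) (by
        have h := congrFun (hx.squared i) n
        simp only [Matrix.diag_apply, Matrix.add_apply, Matrix.smul_apply, Pi.add_apply,
          Pi.sub_apply, Pi.smul_apply, smul_eq_mul, Pi.zero_apply, hV, hY, hG, hz, hh, hr,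
          Finset.mul_sum, ← Finset.sum_add_distrib, ← Finset.sum_sub_distrib] at h
        rw [Finset.sum_const_zero, ← h]
        exact Finset.sum_congr rfl fun l _ => by ring) l
    exact sub_eq_zero.1 (pow_eq_zero_iff two_ne_zero |>.1 h.symm)
  -- Since `s ≥ 0`, `hlin` gives `u ≤ w`; the constraint `diag V = h` then makes `u * u ≤ u * w`
  -- tight.
  have hbin : ∀ l i n, u l i n = 0 ∨ u l i n = w l i := fun l i n => by
    have h : u l i n * u l i n = u l i n * w l i := by
      refine eq_of_sum_eq_of_le (f := fun l => u l i n * u l i n) (g := fun l => u l i n * w l i)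
        (fun l => mul_le_mul_of_nonneg_left ?_ (hu0 l i n)) ?_ l
      · linarith [hlin i n l, hs0 l i n]
      · rw [← hV, ← hh, ← hx.diag_V i]
        rfl
    rcases mul_eq_mul_left_iff.1 h with h | h
    exacts [Or.inr h, Or.inl h]
  have horth : ∀ l i j, i ≠ j → ∀ n, u l i n * u l j n = 0 := fun l i j hij n => by
    have hnn : ∀ l n, 0 ≤ u l i n * u l j n := fun l n => mul_nonneg (hu0 l i n) (hu0 l j n)
    have h := eq_of_sum_eq_of_le (f := fun _ => 0) (g := fun l => ∑ n, u l i n * u l j n)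
      (fun l => Finset.sum_nonneg fun n _ => hnn l n) (by
        rw [Finset.sum_const_zero, ← hx.mem_V.2.2 i j hij, Finset.sum_comm]
        simp [Matrix.trace, hV]) l
    exact (Finset.sum_eq_zero_iff_of_nonneg fun n _ => hnn l n).1 h.symm n (Finset.mem_univ n)
  have hrow : ∀ l i n, u l i n ≠ 0 → u l i n * ∑ k, u l i k = α l * α l := fun l i n h => by
    rw [← hsq i l, Finset.mul_sum]
    refine Finset.sum_congr rfl fun k _ => ?_
    rcases hbin l i k with hk | hk
    · simp [hk]
    · rw [(hbin l i n).resolve_left h, hk, sq]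
  -- By orthogonality at most one cluster is nonzero at point `n`, so the sum is `α l * α l` or `0`.
  -- The constraint `sum_V` rules out `0` whenever `α l ≠ 0`, which is `hcov`.
  have hcovle : ∀ n l, ∑ i, u l i n * ∑ k, u l i k ≤ α l * α l := fun n l => by
    by_cases h : ∃ i, u l i n ≠ 0
    · obtain ⟨i, hi⟩ := h
      rw [Finset.sum_eq_single i, hrow l i n hi]
      · intro j _ hj
        rw [(mul_eq_zero.1 (horth l j i hj n)).resolve_right hi, zero_mul]
      · simp
    · push Not at h
      simpa [h] using mul_self_nonneg (α l)
  have hcov : ∀ l, α l ≠ 0 → ∀ n, ∃ i, u l i n ≠ 0 := fun l hl n => by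
    have h := eq_of_sum_eq_of_le (hcovle n) (by
      rw [hα, ← congrFun hx.sum_V n, Finset.sum_comm, Finset.sum_apply]
      refine Finset.sum_congr rfl fun i _ => ?_
      simp only [Matrix.mulVec, dotProduct, hV, mul_one, Finset.mul_sum]
      exact Finset.sum_comm) l
    by_contra! h0
    simp [h0, hl] at h
  let v : Fin m → ℝ := fun l => (Xᵀ * X).trace - ∑ i, (Xᵀ * X *
    Matrix.vecMulVec (fun n => u l i n / α l) (fun n => u l i n / α l)).trace
  have hv : ∀ l, α l ≠ 0 → v l ∈ kmeansValues K X := fun l hl => by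
    refine mem_kmeansValues_of_indicators X (w := fun i => w l i / α l) (fun i n => ?_)
      (fun i => ?_) (fun i j hij n => ?_) (fun n => ?_)
    · rcases hbin l i n with h | h <;> simp [h]
    · simp only [div_pow, ← Finset.sum_div, hsq]
      field_simp
    · rw [div_mul_div_comm, horth l i j hij, zero_div]
    · obtain ⟨i, hi⟩ := hcov l hl n
      exact ⟨i, div_ne_zero hi hl⟩
  have hscale : ∀ l i, α l * α l * (Xᵀ * X *
      Matrix.vecMulVec (fun n => u l i n / α l) (fun n => u l i n / α l)).trace =
      (Xᵀ * X * Matrix.vecMulVec (u l i) (u l i)).trace := fun l i => by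
    -- This also holds for `α l = 0`, since `hsq` then makes `u l i` vanish.
    have hdiv : ∀ n, α l * (u l i n / α l) = u l i n := fun n => by
      refine mul_div_cancel_of_imp' fun h0 => ?_
      have := hsq i l
      rw [h0, mul_zero] at this
      exact pow_eq_zero_iff two_ne_zero |>.1
        ((Finset.sum_eq_zero_iff_of_nonneg fun _ _ => sq_nonneg _).1 this n (Finset.mem_univ n))
    rw [trace_gram_mul_vecMulVec, trace_gram_mul_vecMulVec, Finset.mul_sum]
    refine Finset.sum_congr rfl fun d _ => ?_
    rw [← sq, ← mul_pow, Finset.mul_sum]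
    congr 1
    refine Finset.sum_congr rfl fun n _ => ?_
    rw [mul_left_comm, hdiv]
  have hobj : objective X x = ∑ l, α l * α l * v l := by
    have hVs : ∀ i, x.V i i = ∑ l, Matrix.vecMulVec (u l i) (u l i) := fun i => by
      ext a b
      rw [hV, Matrix.sum_apply]
      rfl
    simp only [v, mul_sub, Finset.sum_sub_distrib, ← Finset.sum_mul, hα, one_mul]
    simp only [Finset.mul_sum, hscale]
    rw [objective, Finset.sum_comm]
    simp only [hVs, Finset.mul_sum, Matrix.trace_sum]
  -- A weighted average cannot lie strictly below all values of positive weight: otherwise every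
  -- weight would vanish, against `∑ α * α = 1`.
  by_contra! hlt
  have hterm : ∀ l, α l * α l * objective X x ≤ α l * α l * v l := fun l => by
    by_cases hl : α l = 0
    · simp [hl]
    · exact mul_le_mul_of_nonneg_left (hlt _ (hv l hl)).le (mul_self_nonneg _)
  have heq := eq_of_sum_eq_of_le hterm (by rw [← Finset.sum_mul, hα, one_mul, hobj])
  have hzero : ∀ l, α l = 0 := fun l => by
    by_contra hl
    exact (hlt _ (hv l hl)).ne (mul_left_cancel₀ (mul_self_ne_zero.2 hl) (heq l))
  simp [hzero] at hα

/-! ### Attainment of the minimum -/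

/-- For `1 ≤ K ≤ N` there is a feasible clustering. -/
theorem kmeansValues_nonempty {D N K : ℕ} (X : Matrix (Fin D) (Fin N) ℝ) (hK : 1 ≤ K)
    (hKN : K ≤ N) : (kmeansValues K X).Nonempty := by
  classical
  -- The first `K` points get distinct clusters, so none is empty; the rest join cluster `0`.
  let f : Fin N → Fin K := fun n => if h : (n : ℕ) < K then ⟨n, h⟩ else ⟨0, hK⟩
  refine ⟨_, fun i n => if f n = i then 1 else 0, _, ⟨fun i n => ?_, fun i => rfl, fun i => ?_,
    fun n => ?_⟩, rfl⟩
  · by_cases h : f n = i <;> simp [h]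
  · have h1 : f ⟨i, i.2.trans_le hKN⟩ = i := by simp [f]
    calc (1 : ℝ) = if f ⟨i, i.2.trans_le hKN⟩ = i then 1 else 0 := by simp [h1]
      _ ≤ _ := Finset.single_le_sum (f := fun n => if f n = i then (1 : ℝ) else 0)
        (fun k _ => by split_ifs <;> simp) (Finset.mem_univ _)
  · simp

/-- Centroids are determined by the assignment, and there are only finitely many binary assignments.
-/
theorem kmeansValues_finite {D N : ℕ} (K : ℕ) (X : Matrix (Fin D) (Fin N) ℝ) :
    (kmeansValues K X).Finite := by
  have hfin : (Set.univ.pi fun _ : Fin K => Set.univ.pi fun _ : Fin N =>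
      ({0, 1} : Set ℝ)).Finite := Set.Finite.pi fun _ => Set.Finite.pi fun _ => Set.toFinite _
  refine (hfin.image fun π => kmeansCost X π fun i =>
    (1 / ∑ n, π i n) • ∑ n with π i n = 1, point X n).subset ?_
  rintro _ ⟨π, c, h, rfl⟩
  refine ⟨π, fun i _ n _ => h.binary i n, ?_⟩
  rw [show c = _ from funext h.centroid]

end KMeansCPP

/-- The K-means problem and the generalized completely positive program have the same optimal
value (in the extended reals; `⊤` if infeasible), and for `1 ≤ K ≤ N` this value is finite and
is attained as a minimum in both problems. -/
theorem mainTheorem2 (D N K : ℕ) (X : Matrix (Fin D) (Fin N) ℝ) :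
    (⨅ v ∈ KMeansCPP.kmeansValues K X, (v : EReal)) =
        (⨅ v ∈ KMeansCPP.cppValues K X, (v : EReal)) ∧
      (1 ≤ K → K ≤ N → ∃ Zstar : ℝ,
        IsLeast (KMeansCPP.kmeansValues K X) Zstar ∧
        IsLeast (KMeansCPP.cppValues K X) Zstar) := by
  have hsub := KMeansCPP.kmeansValues_subset_cppValues K X
  have hle : ∀ v ∈ KMeansCPP.cppValues K X, ∃ v' ∈ KMeansCPP.kmeansValues K X, v' ≤ v := by
    rintro _ ⟨x, hx, rfl⟩
    exact KMeansCPP.exists_kmeansValue_le X hx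
  refine ⟨le_antisymm (le_iInf₂ fun v hv => ?_) (biInf_mono hsub), fun hK hKN => ?_⟩
  · obtain ⟨v', hv', h⟩ := hle v hv
    exact (iInf₂_le v' hv').trans (EReal.coe_le_coe_iff.2 h)
  · obtain ⟨Z, hZ, hmin⟩ := Set.exists_min_image _ id (KMeansCPP.kmeansValues_finite K X)
      (KMeansCPP.kmeansValues_nonempty X hK hKN)
    refine ⟨Z, ⟨hZ, hmin⟩, hsub hZ, fun v hv => ?_⟩
    obtain ⟨v', hv', h⟩ := hle v hv
    exact (hmin v' hv').trans h
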